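/- Let $F$ be a finite bipartite graph without isolated vertices. In the bipartite achievement game $(F,K_{n,n},+)$ two players, Alice and Bob, alternately choose a not yet coloured edge of the complete bipartite graph $K_{n,n}$. Alice moves first; she colours the edges she chooses blue, and Bob colours those he chooses red. The player who first completes a copy of $F$ (as a not necessarily induced subgraph) in his or her own colour wins; if all edges are coloured and neither player has completed such a copy, nobody wins. The bipartite achievement number $\operatorname{ba}(F)$ is the smallest $n$ for which Alice has a winning strategy in $(F,K_{n,n},+)$. Write $mK_2$ for the disjoint union of $m$ copies of the single-edge graph $K_2$. **Theorem 4.1.** For every integer $m\ge 1$, $$ \operatorname{ba}(mK_2)= \begin{cases} m+1, & m=2 \text{ or } m=3;\\ m, & m=1 \text{ or } m\geq 4. \end{cases} $$ -/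

import Mathlib

/-- The matching `m K₂`: `m` disjoint copies of `K₂`, the `i`-th one having the endpoints
`(i, 0)` and `(i, 1)`. -/
def matchingGraph (m : ℕ) : SimpleGraph (Fin m × Fin 2) where
  Adj p q := p.1 = q.1 ∧ p.2 ≠ q.2
  symm := ⟨fun _ _ h => ⟨h.1.symm, h.2.symm⟩⟩
  loopless := ⟨fun _ h => h.2 rfl⟩

namespace AchievementGame

section Histories

variable {V : Type*}

/-- The edges that Alice has coloured blue. A history of the game is the list of the edges chosen
so far, the most recent one first. Alice moves first, so it is her turn exactly at the histories
of even length. -/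
def blue : List (Sym2 V) → Set (Sym2 V)
  | [] => ∅
  | e :: h => if Even h.length then insert e (blue h) else blue h

/-- The edges that Bob has coloured red. -/
def red : List (Sym2 V) → Set (Sym2 V)
  | [] => ∅
  | e :: h => if Even h.length then red h else insert e (red h)

end Histories

section Rules

variable {W V : Type*} (F : SimpleGraph W) (G : SimpleGraph V)

/-- The edges in `s` form a graph that contains a copy of `F` (as a not necessarily induced
subgraph). -/
def HasCopy (s : Set (Sym2 V)) : Prop :=
  F.IsContained (SimpleGraph.fromEdgeSet s)

/-- The edge `e` may be chosen after the history `h`: it is an uncoloured edge of the board. -/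
def IsLegal (h : List (Sym2 V)) (e : Sym2 V) : Prop :=
  e ∈ G.edgeSet ∧ e ∉ h

/-- The game `(F, G, +)` is over after the history `h`: a player has completed a copy of `F` in
his or her colour, or every edge of the board is coloured. -/
def IsOver (h : List (Sym2 V)) : Prop :=
  HasCopy F (blue h) ∨ HasCopy F (red h) ∨ ∀ e ∈ G.edgeSet, e ∈ h

/-- The histories of `(F, G, +)` that can arise when Alice plays according to the strategy `σ`
(which prescribes a move after each history) and Bob makes arbitrary legal moves. Nobody moves
after the end of the game. -/
inductive Arises (σ : List (Sym2 V) → Sym2 V) : List (Sym2 V) → Prop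
  | start : Arises σ []
  | alice (h : List (Sym2 V)) : Arises σ h → ¬ IsOver F G h → Even h.length →
      IsLegal G h (σ h) → Arises σ (σ h :: h)
  | bob (h : List (Sym2 V)) (f : Sym2 V) : Arises σ h → ¬ IsOver F G h → ¬ Even h.length →
      IsLegal G h f → Arises σ (f :: h)

/-- `σ` is a winning strategy for Alice in `(F, G, +)`: it always prescribes a legal move, and
every finished game in which Alice follows it ends with a blue copy of `F`. Since the game
stops as soon as a player has completed a copy, Alice is then the first to complete one; and
since the board is finite, every game comes to an end. -/
def IsWinningStrategy [Finite V] (σ : List (Sym2 V) → Sym2 V) : Prop :=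
  ∀ h, Arises F G σ h →
    (¬ IsOver F G h → Even h.length → IsLegal G h (σ h)) ∧
    (IsOver F G h → HasCopy F (blue h))

/-- Alice has a winning strategy in the achievement game `(F, G, +)`. -/
def AliceWins [Finite V] : Prop :=
  ∃ σ : List (Sym2 V) → Sym2 V, IsWinningStrategy F G σ

end Rules

end AchievementGame

/-- `ba(F) = k`: the smallest `n` for which Alice has a winning strategy in the achievement game
`(F, K_{n,n}, +)` is `k`. -/
def IsBipartiteAchievementNumber {W : Type*} (F : SimpleGraph W) (k : ℕ) : Prop :=
  IsLeast {n : ℕ | AchievementGame.AliceWins F (completeBipartiteGraph (Fin n) (Fin n))} k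

namespace AchievementGame

/-! ### Strategies and winning positions. -/

section Game

variable {W V : Type*} {F : SimpleGraph W} {G : SimpleGraph V}

/-! Edges of `K_{n,n}` are cells of an `n × n` board, and a copy of `mK₂` is a set of `m` cells with
no two in a line. No such set exists for `n < m`, so only boards with `n ≥ m` matter. Greedy
extension of a matching gives Alice `m = 1` on the `1 × 1` board and `m = 2, 3` with one spare row
and column; on the `2 × 2` and `3 × 3` boards a finite search shows that Bob can prevent a blue
perfect matching.

The substance is `n = m ≥ 4`. Alice enlarges her matching `M` with every move, steering so that red
cells barely touch the unmatched lines (`Sparse`, preserved by `exists_sparse_reply`). Once `M` has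
`n - 1` cells, Bob must take the one completing cell `(x, y)`. Then (`winsFrom_of_deficient`) Alice
rearranges along alternating paths: for suitable `p, q ∈ M`, the cell `(x, p.2)` threatens `(p.1,
y)`; after Bob's forced reply, `(q.1, y)` threatens both `(x, q.2)` and `(p.1, q.2)`. Sparseness
makes these cells available, and it ensures that Bob, having wasted a move or having two cells in
one line, cannot finish first. -/

theorem mem_iff_mem_blue_or_mem_red (h : List (Sym2 V)) (e : Sym2 V) :
    e ∈ h ↔ e ∈ blue h ∨ e ∈ red h := by
  induction h with
  | nil => simp [blue, red]
  | cons f h ih =>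
    by_cases hp : Even h.length <;> simp [blue, red, hp, ih, or_assoc, or_left_comm]

/-- Alice can force a win from the history `h`. -/
inductive Forces (F : SimpleGraph W) (G : SimpleGraph V) : List (Sym2 V) → Prop
  | done (h : List (Sym2 V)) : HasCopy F (blue h) → Forces F G h
  | alice (h : List (Sym2 V)) (e : Sym2 V) : ¬ IsOver F G h → Even h.length → IsLegal G h e →
      Forces F G (e :: h) → Forces F G h
  | bob (h : List (Sym2 V)) : ¬ IsOver F G h → ¬ Even h.length →
      (∀ f, IsLegal G h f → Forces F G (f :: h)) → Forces F G h

theorem Forces.hasCopy_blue {h : List (Sym2 V)} (hf : Forces F G h) (ho : IsOver F G h) :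
    HasCopy F (blue h) := by
  cases hf with
  | done _ hc => exact hc
  | alice _ e hn => exact absurd ho hn
  | bob _ hn => exact absurd ho hn

theorem Forces.exists_move {h : List (Sym2 V)} (hf : Forces F G h) (ho : ¬ IsOver F G h)
    (he : Even h.length) : ∃ e, IsLegal G h e ∧ Forces F G (e :: h) := by
  cases hf with
  | done _ hc => exact absurd (Or.inl hc) ho
  | alice _ e _ _ hl hw => exact ⟨e, hl, hw⟩
  | bob _ _ hn => exact absurd he hn

theorem Forces.reply {h : List (Sym2 V)} (hf : Forces F G h) (ho : ¬ IsOver F G h)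
    (he : ¬ Even h.length) {f : Sym2 V} (hl : IsLegal G h f) : Forces F G (f :: h) := by
  cases hf with
  | done _ hc => exact absurd (Or.inl hc) ho
  | alice _ e _ hn => exact absurd hn he
  | bob _ _ _ hw => exact hw f hl

open Classical in
-- A strategy that moves to a `Forces` position whenever possible never leaves `Forces`, and a
-- finished game there is won. The arbitrary value at other histories is never used.
theorem Forces.aliceWins [Finite V] [Nonempty V] (hf : Forces F G []) : AliceWins F G := by
  have : Nonempty (Sym2 V) := ⟨s(Classical.arbitrary V, Classical.arbitrary V)⟩
  let σ : List (Sym2 V) → Sym2 V := fun h =>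
    if hx : ∃ e, IsLegal G h e ∧ Forces F G (e :: h) then hx.choose else Classical.arbitrary _
  have hσ : ∀ h, (∃ e, IsLegal G h e ∧ Forces F G (e :: h)) →
      IsLegal G h (σ h) ∧ Forces F G (σ h :: h) := by
    intro h hx
    simp only [σ, dif_pos hx]
    exact hx.choose_spec
  have key : ∀ h, Arises F G σ h → Forces F G h := by
    intro h ha
    induction ha with
    | start => exact hf
    | alice h _ ho he _ ih => exact (hσ h (ih.exists_move ho he)).2
    | bob h f _ ho he hl ih => exact ih.reply ho he hl
  exact ⟨σ, fun h ha => ⟨fun ho he => (hσ h ((key h ha).exists_move ho he)).1,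
    fun ho => (key h ha).hasCopy_blue ho⟩⟩

theorem Arises.nodup {σ : List (Sym2 V) → Sym2 V} {h : List (Sym2 V)} (ha : Arises F G σ h) :
    h.Nodup := by
  induction ha with
  | start => exact List.nodup_nil
  | alice h _ _ _ hl ih => exact List.nodup_cons.2 ⟨hl.2, ih⟩
  | bob h f _ _ _ hl ih => exact List.nodup_cons.2 ⟨hl.2, ih⟩

/-- If Bob can keep returning to histories satisfying `P`, and Alice never completes a copy on the
way, then Alice has no winning strategy. -/
theorem not_aliceWins_of_invariant [Finite V] (P : List (Sym2 V) → Prop) (h0 : P [])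
    (heven : ∀ h, P h → Even h.length) (hblue : ∀ h, P h → ¬ HasCopy F (blue h))
    (hstep : ∀ h e, P h → IsLegal G h e → ¬ HasCopy F (blue (e :: h)) ∧
      (¬ IsOver F G (e :: h) → ∃ f, IsLegal G (e :: h) f ∧ P (f :: e :: h))) :
    ¬ AliceWins F G := by
  classical
  have := Fintype.ofFinite V
  rintro ⟨σ, hσ⟩
  -- Termination: a round lengthens the history by two while `k` drops by one, so the strict
  -- inequality survives; at `k = 0` it contradicts the absence of repeated edges.
  have key : ∀ k h, Arises F G σ h → P h → Fintype.card (Sym2 V) < h.length + k → False := by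
    intro k
    induction k with
    | zero =>
      intro h ha _ hk
      exact absurd (ha.nodup.length_le_card) (by omega)
    | succ k ih =>
      intro h ha hp hk
      have ho : ¬ IsOver F G h := fun ho => hblue h hp ((hσ h ha).2 ho)
      have hl := (hσ h ha).1 ho (heven h hp)
      have ha' := Arises.alice h ha ho (heven h hp) hl
      obtain ⟨hb, hr⟩ := hstep h _ hp hl
      have ho' : ¬ IsOver F G (σ h :: h) := fun ho => hb ((hσ _ ha').2 ho)
      obtain ⟨f, hf, hp'⟩ := hr ho'
      refine ih _ (Arises.bob _ f ha' ho' ?_ hf) hp' ?_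
      · have := heven h hp
        simp only [List.length_cons, Nat.even_add_one]
        exact not_not.2 this
      · simp only [List.length_cons]
        omega
  exact key (Fintype.card (Sym2 V) + 1) [] Arises.start h0 (by simp)

end Game

/-! ### From edges of the graph to cells of a square board. -/

section Board

variable {n : ℕ}

/-- The edge of `K_{n,n}` that corresponds to a cell of the `n × n` board. -/
def cellEdge (c : Fin n × Fin n) : Sym2 (Fin n ⊕ Fin n) := s(Sum.inl c.1, Sum.inr c.2)

theorem cellEdge_injective : Function.Injective (cellEdge (n := n)) := by
  rintro ⟨a, b⟩ ⟨c, d⟩ h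
  simpa [cellEdge] using h

theorem mem_edgeSet_completeBipartiteGraph (e : Sym2 (Fin n ⊕ Fin n)) :
    e ∈ (completeBipartiteGraph (Fin n) (Fin n)).edgeSet ↔ ∃ c, cellEdge c = e := by
  induction e using Sym2.ind with
  | _ x y => rcases x with x | x <;> rcases y with y | y <;> simp [cellEdge]

/-- A set of cells, no two of which share a row or a column. -/
def IsMatchingSet (T : Finset (Fin n × Fin n)) : Prop :=
  Set.InjOn Prod.fst (T : Set (Fin n × Fin n)) ∧ Set.InjOn Prod.snd (T : Set (Fin n × Fin n))

/-- `S` contains a matching of size `m`. -/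
def HasMatching (m : ℕ) (S : Finset (Fin n × Fin n)) : Prop :=
  ∃ T ⊆ S, T.card = m ∧ IsMatchingSet T

/-- A copy may send either end of an edge to the row side, but two cells in a common line would
share a vertex, which injectivity of the copy forbids. -/
theorem hasCopy_matchingGraph_iff (m : ℕ) (S : Finset (Fin n × Fin n)) :
    HasCopy (matchingGraph m) (cellEdge '' (S : Set (Fin n × Fin n))) ↔ HasMatching m S := by
  constructor
  · rintro ⟨f⟩
    have hex : ∀ i : Fin m, ∃ c ∈ S, cellEdge c = s(f (i, 0), f (i, 1)) := by
      intro i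
      have h : (matchingGraph m).Adj (i, 0) (i, 1) := ⟨rfl, by simp⟩
      have := f.toHom.map_adj h
      rw [SimpleGraph.fromEdgeSet_adj] at this
      obtain ⟨⟨c, hc, hce⟩, -⟩ := this
      exact ⟨c, hc, hce⟩
    choose c hcS hc using hex
    have hf : ∀ p q, f p = f q → p = q := fun p q h => f.injective h
    have hrow : ∀ i j, (c i).1 = (c j).1 → i = j := by
      intro i j hij
      have h1 : (Sum.inl (c i).1 : Fin n ⊕ Fin n) ∈ s(f (i, 0), f (i, 1)) := by
        rw [← hc]; simp [cellEdge]
      have h2 : (Sum.inl (c i).1 : Fin n ⊕ Fin n) ∈ s(f (j, 0), f (j, 1)) := by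
        rw [← hc, hij]; simp [cellEdge]
      rw [Sym2.mem_iff] at h1 h2
      rcases h1 with h1 | h1 <;> rcases h2 with h2 | h2 <;>
        exact congrArg Prod.fst (hf _ _ (h1.symm.trans h2))
    have hcol : ∀ i j, (c i).2 = (c j).2 → i = j := by
      intro i j hij
      have h1 : (Sum.inr (c i).2 : Fin n ⊕ Fin n) ∈ s(f (i, 0), f (i, 1)) := by
        rw [← hc]; simp [cellEdge]
      have h2 : (Sum.inr (c i).2 : Fin n ⊕ Fin n) ∈ s(f (j, 0), f (j, 1)) := by
        rw [← hc, hij]; simp [cellEdge]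
      rw [Sym2.mem_iff] at h1 h2
      rcases h1 with h1 | h1 <;> rcases h2 with h2 | h2 <;>
        exact congrArg Prod.fst (hf _ _ (h1.symm.trans h2))
    refine ⟨Finset.univ.image c, ?_, ?_, ?_, ?_⟩
    · intro x hx
      obtain ⟨i, -, rfl⟩ := Finset.mem_image.1 hx
      exact hcS i
    · rw [Finset.card_image_of_injective _ (fun i j h => hrow i j (congrArg Prod.fst h))]
      simp
    · intro x hx y hy hxy
      simp only [Finset.coe_image, Finset.coe_univ, Set.image_univ, Set.mem_range] at hx hy
      obtain ⟨i, rfl⟩ := hx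
      obtain ⟨j, rfl⟩ := hy
      rw [hrow i j hxy]
    · intro x hx y hy hxy
      simp only [Finset.coe_image, Finset.coe_univ, Set.image_univ, Set.mem_range] at hx hy
      obtain ⟨i, rfl⟩ := hx
      obtain ⟨j, rfl⟩ := hy
      rw [hcol i j hxy]
  · rintro ⟨T, hTS, hTm, hT1, hT2⟩
    let e : Fin m ≃ T := (Fintype.equivFinOfCardEq (by simpa using hTm)).symm
    let g : Fin m × Fin 2 → Fin n ⊕ Fin n := fun p =>
      if p.2 = 0 then Sum.inl (e p.1).1.1 else Sum.inr (e p.1).1.2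
    have hrow : ∀ i j, (e i).1.1 = (e j).1.1 → i = j := fun i j h =>
      e.injective (Subtype.ext (hT1 (e i).2 (e j).2 h))
    have hcol : ∀ i j, (e i).1.2 = (e j).1.2 → i = j := fun i j h =>
      e.injective (Subtype.ext (hT2 (e i).2 (e j).2 h))
    have hmem : ∀ i, s(Sum.inl (e i).1.1, Sum.inr (e i).1.2) ∈
        cellEdge '' (S : Set (Fin n × Fin n)) := fun i => ⟨(e i).1, hTS (e i).2, rfl⟩
    refine ⟨⟨⟨g, ?_⟩, ?_⟩⟩
    · rintro ⟨i, s⟩ ⟨j, t⟩ ⟨hij, hst⟩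
      obtain rfl : i = j := hij
      rw [SimpleGraph.fromEdgeSet_adj]
      fin_cases s <;> fin_cases t
      · exact absurd rfl hst
      · exact ⟨hmem i, by simp [g]⟩
      · exact ⟨by rw [Sym2.eq_swap]; exact hmem i, by simp [g]⟩
      · exact absurd rfl hst
    · rintro ⟨i, s⟩ ⟨j, t⟩ h
      change g (i, s) = g (j, t) at h
      fin_cases s <;> fin_cases t
      · simp only [g] at h
        simpa using hrow i j (by simpa using h)
      · simp [g] at h
      · simp [g] at h
      · simp only [g] at h
        simpa using hcol i j (by simpa using h)

/-- Alice, to move, can force a matching of size `m` on the `n × n` board, where her cells are `B`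
and Bob's cells are `R`, before Bob has one. -/
inductive WinsFrom (m : ℕ) : Finset (Fin n × Fin n) → Finset (Fin n × Fin n) → Prop
  | win (B R : Finset (Fin n × Fin n)) (c : Fin n × Fin n) : ¬ HasMatching m R → c ∉ B → c ∉ R →
      HasMatching m (insert c B) → WinsFrom m B R
  | step (B R : Finset (Fin n × Fin n)) (c : Fin n × Fin n) : ¬ HasMatching m R → c ∉ B → c ∉ R →
      (∃ d, d ∉ insert c B ∧ d ∉ R) →
      (∀ d, d ∉ insert c B → d ∉ R → WinsFrom m (insert c B) (insert d R)) → WinsFrom m B R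

variable {m : ℕ}

theorem cellEdge_mem_iff {h : List (Sym2 (Fin n ⊕ Fin n))} {B R : Finset (Fin n × Fin n)}
    (hB : blue h = cellEdge '' (B : Set (Fin n × Fin n)))
    (hR : red h = cellEdge '' (R : Set (Fin n × Fin n))) (c : Fin n × Fin n) :
    cellEdge c ∈ h ↔ c ∈ B ∨ c ∈ R := by
  rw [mem_iff_mem_blue_or_mem_red, hB, hR, cellEdge_injective.mem_set_image,
    cellEdge_injective.mem_set_image, Finset.mem_coe, Finset.mem_coe]

theorem isLegal_cellEdge_iff {h : List (Sym2 (Fin n ⊕ Fin n))} {B R : Finset (Fin n × Fin n)}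
    (hB : blue h = cellEdge '' (B : Set (Fin n × Fin n)))
    (hR : red h = cellEdge '' (R : Set (Fin n × Fin n))) (c : Fin n × Fin n) :
    IsLegal (completeBipartiteGraph (Fin n) (Fin n)) h (cellEdge c) ↔ c ∉ B ∧ c ∉ R := by
  rw [IsLegal, cellEdge_mem_iff hB hR, mem_edgeSet_completeBipartiteGraph, not_or]
  exact and_iff_right ⟨c, rfl⟩

theorem not_isOver_of_free {h : List (Sym2 (Fin n ⊕ Fin n))} {B R : Finset (Fin n × Fin n)}
    (hB : blue h = cellEdge '' (B : Set (Fin n × Fin n)))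
    (hR : red h = cellEdge '' (R : Set (Fin n × Fin n))) (hmB : ¬ HasMatching m B)
    (hmR : ¬ HasMatching m R) {c : Fin n × Fin n} (hcB : c ∉ B) (hcR : c ∉ R) :
    ¬ IsOver (matchingGraph m) (completeBipartiteGraph (Fin n) (Fin n)) h := by
  rintro (ho | ho | ho)
  · exact hmB ((hasCopy_matchingGraph_iff m B).1 (hB ▸ ho))
  · exact hmR ((hasCopy_matchingGraph_iff m R).1 (hR ▸ ho))
  · have := (cellEdge_mem_iff hB hR c).1
      (ho _ ((mem_edgeSet_completeBipartiteGraph _).2 ⟨c, rfl⟩))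
    tauto

theorem blue_cons_cellEdge {h : List (Sym2 (Fin n ⊕ Fin n))} {B : Finset (Fin n × Fin n)}
    (hB : blue h = cellEdge '' (B : Set (Fin n × Fin n))) (he : Even h.length)
    (c : Fin n × Fin n) :
    blue (cellEdge c :: h) = cellEdge '' ((insert c B : Finset _) : Set (Fin n × Fin n)) := by
  rw [blue, if_pos he, hB, Finset.coe_insert, Set.image_insert_eq]

theorem red_cons_cellEdge {h : List (Sym2 (Fin n ⊕ Fin n))} {R : Finset (Fin n × Fin n)}
    (hR : red h = cellEdge '' (R : Set (Fin n × Fin n))) (he : ¬ Even h.length)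
    (c : Fin n × Fin n) :
    red (cellEdge c :: h) = cellEdge '' ((insert c R : Finset _) : Set (Fin n × Fin n)) := by
  rw [red, if_neg he, hR, Finset.coe_insert, Set.image_insert_eq]

theorem WinsFrom.forces {B R : Finset (Fin n × Fin n)} (hw : WinsFrom m B R)
    {h : List (Sym2 (Fin n ⊕ Fin n))} (he : Even h.length)
    (hB : blue h = cellEdge '' (B : Set (Fin n × Fin n)))
    (hR : red h = cellEdge '' (R : Set (Fin n × Fin n))) :
    Forces (matchingGraph m) (completeBipartiteGraph (Fin n) (Fin n)) h := by
  induction hw generalizing h with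
  | win B R c hmR hcB hcR hm =>
    by_cases hmB : HasMatching m B
    · exact .done _ (hB ▸ (hasCopy_matchingGraph_iff m B).2 hmB)
    refine .alice _ (cellEdge c) (not_isOver_of_free hB hR hmB hmR hcB hcR) he
      ((isLegal_cellEdge_iff hB hR c).2 ⟨hcB, hcR⟩) (.done _ ?_)
    rw [blue_cons_cellEdge hB he]
    exact (hasCopy_matchingGraph_iff m _).2 hm
  | step B R c hmR hcB hcR hfree _ ih =>
    by_cases hmB : HasMatching m B
    · exact .done _ (hB ▸ (hasCopy_matchingGraph_iff m B).2 hmB)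
    refine .alice _ (cellEdge c) (not_isOver_of_free hB hR hmB hmR hcB hcR) he
      ((isLegal_cellEdge_iff hB hR c).2 ⟨hcB, hcR⟩) ?_
    have hB' := blue_cons_cellEdge hB he c
    have hR' : red (cellEdge c :: h) = cellEdge '' (R : Set (Fin n × Fin n)) := by
      rw [red, if_pos he, hR]
    have he' : ¬ Even (cellEdge c :: h).length := by
      simpa [Nat.even_add_one] using he
    by_cases hmB' : HasMatching m (insert c B)
    · exact .done _ (hB' ▸ (hasCopy_matchingGraph_iff m _).2 hmB')
    -- Without a free cell the game would end here as a draw, while the quantifier over Bob's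
    -- replies would hold vacuously.
    obtain ⟨d, hd⟩ := hfree
    refine .bob _ (not_isOver_of_free hB' hR' hmB' hmR hd.1 hd.2) he' ?_
    intro f hf
    obtain ⟨d, rfl⟩ := (mem_edgeSet_completeBipartiteGraph f).1 hf.1
    have hd := (isLegal_cellEdge_iff hB' hR' d).1 hf
    refine ih d hd.1 hd.2 ?_ ?_ (red_cons_cellEdge hR' he' d)
    · rw [List.length_cons, Nat.even_add_one]
      exact he'
    · rw [blue, if_neg he', hB']

theorem WinsFrom.aliceWins [NeZero n]
    (hw : WinsFrom m (∅ : Finset (Fin n × Fin n)) ∅) :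
    AliceWins (matchingGraph m) (completeBipartiteGraph (Fin n) (Fin n)) :=
  Forces.aliceWins (hw.forces (by simp) (by simp [blue]) (by simp [red]))

end Board

/-! ### Greedy wins on large boards, and Bob's defence on small ones. -/

section Bounds

variable {m n : ℕ}

theorem IsMatchingSet.mono {S T : Finset (Fin n × Fin n)} (hT : IsMatchingSet T) (h : S ⊆ T) :
    IsMatchingSet S :=
  ⟨hT.1.mono (Finset.coe_subset.2 h), hT.2.mono (Finset.coe_subset.2 h)⟩

theorem isMatchingSet_empty : IsMatchingSet (∅ : Finset (Fin n × Fin n)) := by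
  simp [IsMatchingSet]

theorem IsMatchingSet.insert {T : Finset (Fin n × Fin n)} (hT : IsMatchingSet T)
    {c : Fin n × Fin n} (h1 : ∀ t ∈ T, t.1 ≠ c.1) (h2 : ∀ t ∈ T, t.2 ≠ c.2) :
    IsMatchingSet (insert c T) := by
  constructor <;> intro x hx y hy hxy <;>
    rcases Finset.mem_insert.1 (Finset.mem_coe.1 hx) with rfl | hx' <;>
    rcases Finset.mem_insert.1 (Finset.mem_coe.1 hy) with rfl | hy'
  · rfl
  · exact absurd hxy.symm (h1 _ hy')
  · exact absurd hxy (h1 _ hx')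
  · exact hT.1 hx' hy' hxy
  · rfl
  · exact absurd hxy.symm (h2 _ hy')
  · exact absurd hxy (h2 _ hx')
  · exact hT.2 hx' hy' hxy

theorem HasMatching.le_card {S : Finset (Fin n × Fin n)} (h : HasMatching m S) : m ≤ S.card := by
  obtain ⟨T, hTS, hT, -⟩ := h
  exact hT ▸ Finset.card_le_card hTS

theorem HasMatching.le {S : Finset (Fin n × Fin n)} (h : HasMatching m S) : m ≤ n := by
  obtain ⟨T, -, hT, hT1, -⟩ := h
  rw [← hT, ← Finset.card_image_of_injOn hT1]
  simpa using Finset.card_le_univ (T.image Prod.fst)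

/-- A matching of full size meets every row, hence is the graph of a permutation; this makes the
winning lines of the small boards a finite list. -/
theorem HasMatching.exists_perm {S : Finset (Fin n × Fin n)} (h : HasMatching n S) :
    ∃ σ : Equiv.Perm (Fin n), ∀ i, (i, σ i) ∈ S := by
  obtain ⟨T, hTS, hT, hT1, hT2⟩ := h
  have hu : T.image Prod.fst = Finset.univ := by
    rw [← Finset.card_eq_iff_eq_univ, Finset.card_image_of_injOn hT1, hT, Fintype.card_fin]
  have hex : ∀ i, ∃ j, (i, j) ∈ T := by
    intro i
    obtain ⟨⟨a, b⟩, hc, rfl⟩ := Finset.mem_image.1 (hu ▸ Finset.mem_univ i)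
    exact ⟨b, hc⟩
  choose σ hσ using hex
  have hinj : Function.Injective σ := fun i j hij =>
    congrArg Prod.fst (hT2 (hσ i) (hσ j) hij)
  exact ⟨Equiv.ofBijective σ (Finite.injective_iff_bijective.1 hinj), fun i => hTS (hσ i)⟩

/-- A pigeonhole count: the part of the board left over by a matching of size `k` has an uncoloured
cell if there are fewer than `(n - k) ^ 2` red cells. -/
theorem exists_free_cell {M R : Finset (Fin n × Fin n)} (hM : IsMatchingSet M)
    (h : R.card < (n - M.card) ^ 2) :
    ∃ c : Fin n × Fin n, c ∉ R ∧ (∀ t ∈ M, t.1 ≠ c.1) ∧ (∀ t ∈ M, t.2 ≠ c.2) := by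
  have hcard : ((M.image Prod.fst)ᶜ ×ˢ (M.image Prod.snd)ᶜ).card = (n - M.card) ^ 2 := by
    rw [Finset.card_product, Finset.card_compl, Finset.card_compl,
      Finset.card_image_of_injOn hM.1, Finset.card_image_of_injOn hM.2, Fintype.card_fin, sq]
  obtain ⟨c, hc, hcR⟩ := Finset.exists_mem_notMem_of_card_lt_card (hcard ▸ h)
  simp only [Finset.mem_product, Finset.mem_compl, Finset.mem_image, not_exists, not_and] at hc
  exact ⟨c, hcR, hc.1, hc.2⟩

/-- If the board is large enough, Alice wins by building a matching greedily. -/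
theorem winsFrom_of_greedy (hmn : ∀ k < m, k < (n - k) ^ 2) (j : ℕ) :
    ∀ M R : Finset (Fin n × Fin n), IsMatchingSet M → M.card + (j + 1) = m → R.card = M.card →
      WinsFrom m M R := by
  induction j with
  | zero =>
    intro M R hM hMm hR
    obtain ⟨c, hcR, h1, h2⟩ := exists_free_cell (R := R) hM (hR ▸ hmn _ (by omega))
    have hcM : c ∉ M := fun hc => h1 c hc rfl
    refine .win M R c (fun h => by have := h.le_card; omega) hcM hcR
      ⟨_, subset_rfl, ?_, hM.insert h1 h2⟩
    rw [Finset.card_insert_of_notMem hcM]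
    omega
  | succ j ih =>
    intro M R hM hMm hR
    obtain ⟨c, hcR, h1, h2⟩ := exists_free_cell (R := R) hM (hR ▸ hmn _ (by omega))
    have hcM : c ∉ M := fun hc => h1 c hc rfl
    have hM' := hM.insert h1 h2
    have hcard : (insert c M).card = M.card + 1 := Finset.card_insert_of_notMem hcM
    refine .step M R c (fun h => by have := h.le_card; omega) hcM hcR ?_ ?_
    · obtain ⟨d, hdR, hd, -⟩ := exists_free_cell (R := R) hM' (by
        rw [hcard, hR]
        exact (Nat.lt_succ_self _).trans (hmn _ (by omega)))
      exact ⟨d, fun h => hd d h rfl, hdR⟩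
    · intro d _ hdR
      refine ih _ _ hM' (by omega) ?_
      rw [Finset.card_insert_of_notMem hdR, hcard, hR]

theorem aliceWins_of_greedy (hm : 0 < m) (hmn : ∀ k < m, k < (n - k) ^ 2) :
    AliceWins (matchingGraph m) (completeBipartiteGraph (Fin n) (Fin n)) := by
  have : NeZero n := ⟨by
    rintro rfl
    simpa using hmn 0 hm⟩
  obtain ⟨j, rfl⟩ := Nat.exists_eq_succ_of_ne_zero hm.ne'
  exact (winsFrom_of_greedy hmn j ∅ ∅ isMatchingSet_empty (by simp) rfl).aliceWins

/-- The form of `not_aliceWins_of_invariant` in which positions are pairs of blue and red cell sets.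
-/
theorem not_aliceWins_of_cells (Q : Finset (Fin n × Fin n) → Finset (Fin n × Fin n) → Prop)
    (h0 : Q ∅ ∅) (hblue : ∀ B R, Q B R → ¬ HasMatching m B)
    (hstep : ∀ B R c, Q B R → c ∉ B → c ∉ R → ¬ HasMatching m (insert c B) ∧
      ((∃ d, d ∉ insert c B ∧ d ∉ R) →
        ∃ d, d ∉ insert c B ∧ d ∉ R ∧ Q (insert c B) (insert d R))) :
    ¬ AliceWins (matchingGraph m) (completeBipartiteGraph (Fin n) (Fin n)) := by
  refine not_aliceWins_of_invariant (fun h => Even h.length ∧ ∃ B R : Finset (Fin n × Fin n),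
    blue h = cellEdge '' (B : Set (Fin n × Fin n)) ∧
    red h = cellEdge '' (R : Set (Fin n × Fin n)) ∧ Q B R)
    ⟨by simp, ∅, ∅, by simp [blue], by simp [red], h0⟩ (fun h hp => hp.1) ?_ ?_
  · rintro h ⟨-, B, R, hB, -, hQ⟩ hc
    exact hblue B R hQ ((hasCopy_matchingGraph_iff m B).1 (hB ▸ hc))
  · rintro h e ⟨he, B, R, hB, hR, hQ⟩ hl
    obtain ⟨c, rfl⟩ := (mem_edgeSet_completeBipartiteGraph e).1 hl.1
    have hc := (isLegal_cellEdge_iff hB hR c).1 hl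
    obtain ⟨hnm, hd⟩ := hstep B R c hQ hc.1 hc.2
    have hB' := blue_cons_cellEdge hB he c
    have hR' : red (cellEdge c :: h) = cellEdge '' (R : Set (Fin n × Fin n)) := by
      rw [red, if_pos he, hR]
    have he' : ¬ Even (cellEdge c :: h).length := by
      simpa [Nat.even_add_one] using he
    refine ⟨fun hcp => hnm ((hasCopy_matchingGraph_iff m _).1 (hB' ▸ hcp)), fun ho => ?_⟩
    have hfree : ∃ d, d ∉ insert c B ∧ d ∉ R := by
      by_contra hno
      push Not at hno
      refine ho (Or.inr (Or.inr fun f hf => ?_))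
      obtain ⟨d, rfl⟩ := (mem_edgeSet_completeBipartiteGraph f).1 hf
      rw [cellEdge_mem_iff hB' hR']
      by_cases hd : d ∈ insert c B
      · exact Or.inl hd
      · exact Or.inr (hno d hd)
    obtain ⟨d, hdB, hdR, hQ'⟩ := hd hfree
    refine ⟨cellEdge d, (isLegal_cellEdge_iff hB' hR' d).2 ⟨hdB, hdR⟩, ?_, insert c B, insert d R,
      ?_, red_cons_cellEdge hR' he' d, hQ'⟩
    · rw [List.length_cons, Nat.even_add_one]
      exact he'
    · rw [blue, if_neg he', hB']

theorem not_aliceWins_of_lt (h : n < m) :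
    ¬ AliceWins (matchingGraph m) (completeBipartiteGraph (Fin n) (Fin n)) := by
  have hno : ∀ S : Finset (Fin n × Fin n), ¬ HasMatching m S := fun S hS =>
    absurd hS.le (by omega)
  exact not_aliceWins_of_cells (fun _ _ => True) trivial (fun B _ _ => hno B)
    (fun B R c _ _ _ => ⟨hno _, fun ⟨d, hd1, hd2⟩ => ⟨d, hd1, hd2, trivial⟩⟩)

/-- Bob, moving second, can prevent Alice from completing one of the lines in `lines`, where `free`
lists the uncoloured cells and `L` Alice's cells, and at most `k` further rounds are played. -/
def bobHolds (lines : List (List (Fin n × Fin n))) :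
    ℕ → List (Fin n × Fin n) → List (Fin n × Fin n) → Bool
  | 0, free, _ => free.isEmpty
  | k + 1, free, L => free.all fun c =>
      !(lines.any fun t => t.all fun x => (c :: L).contains x) &&
        ((free.erase c).isEmpty ||
          (free.erase c).any fun d => bobHolds lines k ((free.erase c).erase d) (c :: L))

/-- Bob only needs to deny Alice a matching, since a red one would also end the game without her
winning. Hence the search need not record red cells: the free cells and Alice's cells suffice. -/
theorem not_aliceWins_of_bobHolds (lines : List (List (Fin n × Fin n)))
    (hm : 0 < m)
    (hlines : ∀ S : Finset (Fin n × Fin n), HasMatching m S → ∃ t ∈ lines, ∀ x ∈ t, x ∈ S)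
    (free : List (Fin n × Fin n)) (hfree : ∀ c, c ∈ free) (hnd : free.Nodup)
    (k : ℕ) (hk : bobHolds lines k free [] = true) :
    ¬ AliceWins (matchingGraph m) (completeBipartiteGraph (Fin n) (Fin n)) := by
  refine not_aliceWins_of_cells (fun B R => ¬ HasMatching m B ∧ ∃ k f L, L.toFinset = B ∧
    (∀ c, c ∈ f ↔ c ∉ B ∧ c ∉ R) ∧ f.Nodup ∧ bobHolds lines k f L = true) ?_
    (fun B R h => h.1) ?_
  · refine ⟨fun h => ?_, k, free, [], rfl, by simpa using hfree, hnd, hk⟩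
    have := h.le_card
    simp at this
    omega
  · rintro B R c ⟨-, k, f, L, rfl, hf, hfn, hh⟩ hcB hcR
    have hcf := (hf c).2 ⟨hcB, hcR⟩
    cases k with
    | zero =>
      rw [bobHolds, List.isEmpty_iff] at hh
      simp [hh] at hcf
    | succ k =>
      rw [bobHolds, List.all_eq_true] at hh
      have h1 := hh c hcf
      rw [Bool.and_eq_true, Bool.not_eq_true', Bool.or_eq_true, List.isEmpty_iff,
        List.any_eq_true] at h1
      obtain ⟨hl, hr⟩ := h1
      have hnm : ¬ HasMatching m (insert c L.toFinset) := by
        intro hmat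
        obtain ⟨t, ht, hx⟩ := hlines _ hmat
        rw [List.any_eq_false] at hl
        refine hl t ht (List.all_eq_true.2 fun x hxt => ?_)
        have := hx x hxt
        simpa using this
      refine ⟨hnm, fun ⟨d, hd1, hd2⟩ => ?_⟩
      have hmem : ∀ d, d ∈ f.erase c ↔ d ∉ insert c L.toFinset ∧ d ∉ R := by
        intro d
        rw [hfn.mem_erase_iff, hf, Finset.mem_insert]
        tauto
      rcases hr with hr | ⟨d, hd, hh'⟩
      · have := (hmem d).2 ⟨hd1, hd2⟩
        simp [hr] at this
      · refine ⟨d, ((hmem d).1 hd).1, ((hmem d).1 hd).2, hnm, k, _, _, ?_, ?_, ?_, hh'⟩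
        · simp
        · intro x
          rw [(hfn.erase c).mem_erase_iff, hmem, Finset.mem_insert (s := R)]
          tauto
        · exact (hfn.erase c).erase d

theorem not_aliceWins_two :
    ¬ AliceWins (matchingGraph 2) (completeBipartiteGraph (Fin 2) (Fin 2)) := by
  refine not_aliceWins_of_bobHolds [[(0, 0), (1, 1)], [(0, 1), (1, 0)]] (by norm_num) ?_
    [(0, 0), (0, 1), (1, 0), (1, 1)] (by decide) (by decide) 2 (by decide +kernel)
  intro S hS
  obtain ⟨σ, hσ⟩ := hS.exists_perm
  have key : ∀ σ : Equiv.Perm (Fin 2), ∃ t ∈ [[((0 : Fin 2), (0 : Fin 2)), (1, 1)],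
      [(0, 1), (1, 0)]], ∀ x ∈ t, x.2 = σ x.1 := by decide
  obtain ⟨t, ht, hx⟩ := key σ
  exact ⟨t, ht, fun x hxt => by simpa [← hx x hxt] using hσ x.1⟩

theorem not_aliceWins_three :
    ¬ AliceWins (matchingGraph 3) (completeBipartiteGraph (Fin 3) (Fin 3)) := by
  refine not_aliceWins_of_bobHolds [[(0, 0), (1, 1), (2, 2)], [(0, 1), (1, 2), (2, 0)],
      [(0, 2), (1, 0), (2, 1)], [(0, 0), (1, 2), (2, 1)], [(0, 1), (1, 0), (2, 2)],
      [(0, 2), (1, 1), (2, 0)]] (by norm_num) ?_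
    [(0, 0), (0, 1), (0, 2), (1, 0), (1, 1), (1, 2), (2, 0), (2, 1), (2, 2)]
    (by decide) (by decide) 5 (by decide +kernel)
  intro S hS
  obtain ⟨σ, hσ⟩ := hS.exists_perm
  have key : ∀ σ : Equiv.Perm (Fin 3), ∃ t ∈ [[((0 : Fin 3), (0 : Fin 3)), (1, 1), (2, 2)],
      [(0, 1), (1, 2), (2, 0)], [(0, 2), (1, 0), (2, 1)], [(0, 0), (1, 2), (2, 1)],
      [(0, 1), (1, 0), (2, 2)], [(0, 2), (1, 1), (2, 0)]], ∀ x ∈ t, x.2 = σ x.1 := by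
    decide +kernel
  obtain ⟨t, ht, hx⟩ := key σ
  exact ⟨t, ht, fun x hxt => by simpa [← hx x hxt] using hσ x.1⟩

end Bounds

/-! ### Symmetry under transposing the board. -/

section Swap

variable {m n : ℕ}

/-- The set of cells obtained by exchanging rows and columns. -/
def swapCells (S : Finset (Fin n × Fin n)) : Finset (Fin n × Fin n) := S.image Prod.swap

theorem mem_swapCells {S : Finset (Fin n × Fin n)} {c : Fin n × Fin n} :
    c ∈ swapCells S ↔ c.swap ∈ S := by
  simp only [swapCells, Finset.mem_image]
  exact ⟨fun ⟨a, ha, h⟩ => by rw [← h, Prod.swap_swap]; exact ha, fun h => ⟨_, h, c.swap_swap⟩⟩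

theorem swapCells_swapCells (S : Finset (Fin n × Fin n)) : swapCells (swapCells S) = S := by
  ext c
  simp [mem_swapCells]

theorem swapCells_insert (c : Fin n × Fin n) (S : Finset (Fin n × Fin n)) :
    swapCells (insert c S) = insert c.swap (swapCells S) := Finset.image_insert _ _ _

theorem card_swapCells (S : Finset (Fin n × Fin n)) : (swapCells S).card = S.card :=
  Finset.card_image_of_injective _ Prod.swap_injective

theorem IsMatchingSet.swapCells {T : Finset (Fin n × Fin n)} (hT : IsMatchingSet T) :
    IsMatchingSet (swapCells T) := by
  constructor <;> intro x hx y hy hxy <;>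
    rw [Finset.mem_coe, mem_swapCells] at hx hy
  · exact Prod.swap_injective (hT.2 hx hy hxy)
  · exact Prod.swap_injective (hT.1 hx hy hxy)

theorem HasMatching.swapCells {S : Finset (Fin n × Fin n)} (h : HasMatching m S) :
    HasMatching m (swapCells S) := by
  obtain ⟨T, hTS, hT, hTm⟩ := h
  exact ⟨AchievementGame.swapCells T, Finset.image_subset_image hTS, by rw [card_swapCells, hT],
    hTm.swapCells⟩

theorem hasMatching_swapCells_iff {S : Finset (Fin n × Fin n)} :
    HasMatching m (swapCells S) ↔ HasMatching m S :=
  ⟨fun h => swapCells_swapCells S ▸ h.swapCells, fun h => h.swapCells⟩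

theorem WinsFrom.swapCells {B R : Finset (Fin n × Fin n)} (h : WinsFrom m B R) :
    WinsFrom m (swapCells B) (swapCells R) := by
  induction h with
  | win B R c hR hcB hcR hm =>
    refine .win _ _ c.swap (by rwa [hasMatching_swapCells_iff]) (by simpa [mem_swapCells])
      (by simpa [mem_swapCells]) ?_
    rw [← swapCells_insert]
    exact hm.swapCells
  | step B R c hR hcB hcR hfree _ ih =>
    refine .step _ _ c.swap (by rwa [hasMatching_swapCells_iff]) (by simpa [mem_swapCells])
      (by simpa [mem_swapCells]) ?_ ?_
    · obtain ⟨d, hd1, hd2⟩ := hfree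
      refine ⟨d.swap, ?_, by simpa [mem_swapCells]⟩
      rw [← swapCells_insert, mem_swapCells, Prod.swap_swap]
      exact hd1
    · intro d hd1 hd2
      rw [← swapCells_insert, mem_swapCells] at hd1
      rw [mem_swapCells] at hd2
      have := ih d.swap hd1 hd2
      rwa [swapCells_insert, swapCells_insert, Prod.swap_swap] at this

end Swap

/-! ### The forced win from an almost perfect matching. -/

section Endgame

variable {m n : ℕ}

/-- Removing one cell costs a matching at most one cell. This lets a bound on Bob's present position
exclude a win on his next move. -/
theorem HasMatching.of_insert {S : Finset (Fin n × Fin n)} {d : Fin n × Fin n}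
    (h : HasMatching n (insert d S)) : HasMatching (n - 1) S := by
  obtain ⟨T, hTS, hT, hTm⟩ := h
  have hc := Finset.pred_card_le_card_erase (a := d) (s := T)
  rw [hT] at hc
  obtain ⟨U, hU, hUc⟩ := Finset.exists_subset_card_eq hc
  refine ⟨U, hU.trans ?_, hUc, hTm.mono (hU.trans (Finset.erase_subset _ _))⟩
  rw [← Finset.subset_insert_iff]
  exact hTS

theorem HasMatching.mono {S S' : Finset (Fin n × Fin n)} (h : HasMatching m S) (hS : S ⊆ S') :
    HasMatching m S' := by
  obtain ⟨T, hTS, hT⟩ := h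
  exact ⟨T, hTS.trans hS, hT⟩

theorem hasMatching_insert_of_card {M S : Finset (Fin n × Fin n)} (hM : IsMatchingSet M)
    (hcard : M.card + 1 = m) (hS : M ⊆ S) {c : Fin n × Fin n} (hrow : ∀ t ∈ M, t.1 ≠ c.1)
    (hcol : ∀ t ∈ M, t.2 ≠ c.2) (hc : c ∈ S) : HasMatching m S := by
  refine ⟨insert c M, Finset.insert_subset hc hS, ?_, hM.insert hrow hcol⟩
  rw [Finset.card_insert_of_notMem (fun h => hrow c h rfl), hcard]

/-- Augmentation of a matching along a path with three edges. -/
theorem hasMatching_of_augment {M S : Finset (Fin n × Fin n)} (hM : IsMatchingSet M)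
    (hcard : M.card + 1 = m) {x y : Fin n} (hx : ∀ t ∈ M, t.1 ≠ x) (hy : ∀ t ∈ M, t.2 ≠ y)
    {q : Fin n × Fin n} (hq : q ∈ M) (hS : M.erase q ⊆ S) (hxq : (x, q.2) ∈ S)
    (hqy : (q.1, y) ∈ S) : HasMatching m S := by
  have hM1 : IsMatchingSet (insert (x, q.2) (M.erase q)) := by
    refine (hM.mono (Finset.erase_subset _ _)).insert
      (fun t ht => hx t (Finset.mem_of_mem_erase ht)) (fun t ht h => ?_)
    exact Finset.ne_of_mem_erase ht (hM.2 (Finset.mem_of_mem_erase ht) hq h)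
  refine hasMatching_insert_of_card hM1 ?_ (Finset.insert_subset hxq hS) (c := (q.1, y)) ?_ ?_ hqy
  · rw [Finset.card_insert_of_notMem
      (fun h => hx _ (Finset.mem_of_mem_erase h) rfl), Finset.card_erase_add_one hq, hcard]
  · intro t ht h
    rcases Finset.mem_insert.1 ht with rfl | ht
    · exact hx q hq h.symm
    · exact Finset.ne_of_mem_erase ht (hM.1 (Finset.mem_of_mem_erase ht) hq h)
  · intro t ht h
    rcases Finset.mem_insert.1 ht with rfl | ht
    · exact hy q hq h
    · exact hy t (Finset.mem_of_mem_erase ht) h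

/-- Alice's double threat: she lacks only the row `x` and the column `y`, it is her turn, and Bob,
who owns `(x, y)`, is behind. -/
theorem winsFrom_of_deficient (hn : 4 ≤ n) {M R : Finset (Fin n × Fin n)} (hM : IsMatchingSet M)
    (hMc : M.card = n - 1) (hRc : R.card = n - 1) {x y : Fin n}
    (hx : ∀ t ∈ M, t.1 ≠ x) (hy : ∀ t ∈ M, t.2 ≠ y) (hxy : (x, y) ∈ R)
    (hxR : ∀ r ∈ R, r.1 = x → r = (x, y)) (he : (R.filter (fun r => r.2 = y)).card ≤ 2)
    (hbehind : (R.filter (fun r => r.2 = y)).card = 2 ∨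
      ¬ IsMatchingSet (R.filter (fun r => r.2 ≠ y))) :
    WinsFrom n M R := by
  have hsum : (R.filter (fun r => r.2 = y)).card + (R.filter (fun r => r.2 ≠ y)).card =
      R.card := Finset.card_filter_add_card_filter_not _
  have he1 : 0 < (R.filter (fun r => r.2 = y)).card :=
    Finset.card_pos.2 ⟨(x, y), by simp [hxy]⟩
  -- A matching uses at most one cell of column `y`. If `R` has two cells there, only `n - 3` lie
  -- elsewhere; if it has one, an `(n - 1)`-matching would need all `n - 2` others, and those are
  -- not a matching.
  have hslow : ∀ u, ¬ HasMatching (n - 1) (insert (u, y) R) := by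
    rintro u ⟨T, hTR, hTc, hTm⟩
    have hsub : T.filter (fun r => r.2 ≠ y) ⊆ R.filter (fun r => r.2 ≠ y) := by
      intro r hr
      rw [Finset.mem_filter] at hr ⊢
      refine ⟨?_, hr.2⟩
      rcases Finset.mem_insert.1 (hTR hr.1) with rfl | h
      · exact absurd rfl hr.2
      · exact h
    have hone : (T.filter (fun r => r.2 = y)).card ≤ 1 := by
      rw [Finset.card_le_one]
      intro a ha b hb
      rw [Finset.mem_filter] at ha hb
      exact hTm.2 ha.1 hb.1 (ha.2.trans hb.2.symm)
    have hsumT : (T.filter (fun r => r.2 = y)).card + (T.filter (fun r => r.2 ≠ y)).card =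
      T.card := Finset.card_filter_add_card_filter_not _
    have hle := Finset.card_le_card hsub
    rcases hbehind with h2 | hnm
    · omega
    · have heq := Finset.eq_of_subset_of_card_le hsub (by omega)
      exact hnm (heq ▸ hTm.mono (Finset.filter_subset _ _))
  have hR0 : ¬ HasMatching n R := fun h => by
    have := h.le_card
    omega
  have hR1 : ∀ d, ¬ HasMatching n (insert d R) := fun d h =>
    hslow x (h.of_insert.mono (Finset.subset_insert _ _))
  have hR2 : ∀ u d, ¬ HasMatching n (insert d (insert (u, y) R)) := fun u d h =>
    hslow u h.of_insert
  -- The cells of `M` through which a path to the missing column `y` is still open. Each row outside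
  -- `P`, including `x`, has a red cell in column `y`.
  let P := M.filter (fun p => (p.1, y) ∉ R)
  have hP : n ≤ P.card + (R.filter (fun r => r.2 = y)).card := by
    have hrows : M.image Prod.fst = Finset.univ.erase x := by
      refine Finset.eq_of_subset_of_card_le (fun i hi => ?_) ?_
      · obtain ⟨t, ht, rfl⟩ := Finset.mem_image.1 hi
        exact Finset.mem_erase.2 ⟨hx t ht, Finset.mem_univ _⟩
      · rw [Finset.card_image_of_injOn hM.1, Finset.card_erase_of_mem (Finset.mem_univ _), hMc]
        simp
    have hcover : (Finset.univ : Finset (Fin n)) ⊆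
        P.image Prod.fst ∪ (R.filter (fun r => r.2 = y)).image Prod.fst := by
      intro i _
      by_cases hi : (i, y) ∈ R
      · exact Finset.mem_union_right _
          (Finset.mem_image.2 ⟨(i, y), Finset.mem_filter.2 ⟨hi, rfl⟩, rfl⟩)
      · have hix : i ≠ x := by
          rintro rfl
          exact hi hxy
        have : i ∈ M.image Prod.fst := by
          rw [hrows]
          exact Finset.mem_erase.2 ⟨hix, Finset.mem_univ _⟩
        obtain ⟨t, ht, rfl⟩ := Finset.mem_image.1 this
        exact Finset.mem_union_left _
          (Finset.mem_image.2 ⟨t, Finset.mem_filter.2 ⟨ht, hi⟩, rfl⟩)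
    have h1 := (Finset.card_le_card hcover).trans (Finset.card_union_le _ _)
    rw [Finset.card_univ, Fintype.card_fin] at h1
    exact h1.trans (Nat.add_le_add Finset.card_image_le Finset.card_image_le)
  obtain ⟨p, hp, q, hq, hpq, hpqR⟩ : ∃ p ∈ P, ∃ q ∈ P, p ≠ q ∧ (p.1, q.2) ∉ R := by
    -- Otherwise ordered pairs from `P` inject into the red cells off column `y`. With `e ≤ 2` red
    -- cells in that column, `|P| ≥ n - e ≥ 2` (here `n ≥ 4` enters), so there are at least `n - e`
    -- pairs but only `n - 1 - e` such red cells.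
    by_contra! hno
    have hmaps : P.offDiag.card ≤ (R.filter (fun r => r.2 ≠ y)).card := by
      refine Finset.card_le_card_of_injOn (fun s => (s.1.1, s.2.2)) (fun s hs => ?_) ?_
      · rw [Finset.mem_coe, Finset.mem_offDiag] at hs
        exact Finset.mem_coe.2 (Finset.mem_filter.2 ⟨hno _ hs.1 _ hs.2.1 hs.2.2,
          hy s.2 (Finset.mem_filter.1 hs.2.1).1⟩)
      · intro s hs t ht hst
        rw [Finset.mem_coe, Finset.mem_offDiag] at hs ht
        rw [Prod.mk.injEq] at hst
        exact Prod.ext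
          (hM.1 (Finset.mem_filter.1 hs.1).1 (Finset.mem_filter.1 ht.1).1 hst.1)
          (hM.2 (Finset.mem_filter.1 hs.2.1).1 (Finset.mem_filter.1 ht.2.1).1 hst.2)
    rw [Finset.offDiag_card] at hmaps
    have h2 : 2 * P.card ≤ P.card * P.card := Nat.mul_le_mul_right _ (by omega)
    omega
  obtain ⟨hpM, hpy⟩ := Finset.mem_filter.1 hp
  obtain ⟨hqM, hqy⟩ := Finset.mem_filter.1 hq
  have hMc' : M.card + 1 = n := by omega
  have hxM : ∀ j, (x, j) ∉ M := fun j h => hx _ h rfl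
  have hyM : ∀ i, (i, y) ∉ M := fun i h => hy _ h rfl
  have hxp : (x, p.2) ∉ R := fun h => hy p hpM (congrArg Prod.snd (hxR _ h rfl))
  have hxq : (x, q.2) ∉ R := fun h => hy q hqM (congrArg Prod.snd (hxR _ h rfl))
  have hpqM : (p.1, q.2) ∉ M := fun h =>
    hpq ((hM.1 h hpM rfl).symm.trans (hM.2 h hqM rfl))
  have hp1q1 : p.1 ≠ q.1 := fun h => hpq (hM.1 hpM hqM h)
  have hp2q2 : p.2 ≠ q.2 := fun h => hpq (hM.2 hpM hqM h)
  have hp1x := hx p hpM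
  have hq1x := hx q hqM
  have hp2y := hy p hpM
  have hq2y := hy q hqM
  have hfree1 : (p.1, y) ∉ insert (x, p.2) M := by
    rw [Finset.mem_insert, Prod.mk.injEq]
    exact fun h => h.elim (fun h => hp1x h.1) (hyM _)
  -- First threat: replacing `p` by `(x, p.2)` and `(p.1, y)`.
  refine .step M R (x, p.2) hR0 (hxM _) hxp ⟨(p.1, y), hfree1, hpy⟩ (fun d hd1 hd2 => ?_)
  by_cases hd : d = (p.1, y)
  swap
  · refine .win _ _ (p.1, y) (hR1 d) hfree1 ?_ ?_
    · rw [Finset.mem_insert]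
      exact fun h => h.elim (fun h => hd h.symm) hpy
    · refine hasMatching_of_augment hM hMc' hx hy hpM
        (fun t ht => ?_) (by simp) (by simp)
      simp [Finset.mem_of_mem_erase ht]
  subst hd
  set B1 := insert (x, p.2) M with hB1
  set R1 := insert (p.1, y) R with hR1_def
  have hR1c : ¬ HasMatching n R1 := hR1 _
  have hqyB : (q.1, y) ∉ B1 := by
    rw [hB1, Finset.mem_insert, Prod.mk.injEq]
    exact fun h => h.elim (fun h => hq1x h.1) (hyM _)
  have hqyR : (q.1, y) ∉ R1 := by
    rw [hR1_def, Finset.mem_insert, Prod.mk.injEq]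
    exact fun h => h.elim (fun h => hp1q1 h.1.symm) hqy
  have hxqB : (x, q.2) ∉ insert (q.1, y) B1 := by
    rw [hB1, Finset.mem_insert, Finset.mem_insert, Prod.mk.injEq, Prod.mk.injEq]
    rintro (h | h | h)
    · exact hq1x h.1.symm
    · exact hp2q2 h.2.symm
    · exact hxM _ h
  have hxqR : (x, q.2) ∉ R1 := by
    rw [hR1_def, Finset.mem_insert, Prod.mk.injEq]
    exact fun h => h.elim (fun h => hq2y h.2) hxq
  have hpqB : (p.1, q.2) ∉ insert (q.1, y) B1 := by
    rw [hB1, Finset.mem_insert, Finset.mem_insert, Prod.mk.injEq, Prod.mk.injEq]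
    rintro (h | h | h)
    · exact hp1q1 h.1
    · exact hp1x h.1
    · exact hpqM h
  have hpqR1 : (p.1, q.2) ∉ R1 := by
    rw [hR1_def, Finset.mem_insert, Prod.mk.injEq]
    exact fun h => h.elim (fun h => hq2y h.2) hpqR
  -- Double threat: `(x, q.2)` replaces `q` alone, whereas `(p.1, q.2)` closes the longer path
  -- replacing both `p` and `q`.
  refine .step B1 R1 (q.1, y) hR1c hqyB hqyR ⟨_, hxqB, hxqR⟩ (fun d _ _ => ?_)
  by_cases hd : d = (x, q.2)
  swap
  · refine .win _ _ (x, q.2) (hR2 _ d) hxqB ?_ ?_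
    · rw [Finset.mem_insert]
      exact fun h => h.elim (fun h => hd h.symm) hxqR
    · refine hasMatching_of_augment hM hMc' hx hy hqM
        (fun t ht => ?_) (by simp) (by simp)
      simp [hB1, Finset.mem_of_mem_erase ht]
  subst hd
  refine .win _ _ (p.1, q.2) (hR2 _ _) hpqB ?_ ?_
  · rw [Finset.mem_insert, Prod.mk.injEq]
    exact fun h => h.elim (fun h => hp1x h.1) hpqR1
  -- After exchanging `p` for `(x, p.2)`, the missing row is `p.1`; the three-edge augmentation
  -- through `q` now applies with that row.
  · have hM1 : IsMatchingSet (insert (x, p.2) (M.erase p)) := by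
      refine (hM.mono (Finset.erase_subset _ _)).insert
        (fun t ht => hx t (Finset.mem_of_mem_erase ht)) (fun t ht h => ?_)
      exact Finset.ne_of_mem_erase ht (hM.2 (Finset.mem_of_mem_erase ht) hpM h)
    refine hasMatching_of_augment (x := p.1) (y := y) (q := q) hM1 ?_ ?_ ?_ ?_ ?_ (by simp)
      (by simp)
    · rw [Finset.card_insert_of_notMem (fun h => hxM _ (Finset.mem_of_mem_erase h)),
        Finset.card_erase_add_one hpM, hMc']
    · intro t ht h
      rcases Finset.mem_insert.1 ht with rfl | ht
      · exact hp1x h.symm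
      · exact Finset.ne_of_mem_erase ht (hM.1 (Finset.mem_of_mem_erase ht) hpM h)
    · intro t ht h
      rcases Finset.mem_insert.1 ht with rfl | ht
      · exact hp2y h
      · exact hy t (Finset.mem_of_mem_erase ht) h
    · exact Finset.mem_insert_of_mem (Finset.mem_erase.2 ⟨hpq.symm, hqM⟩)
    · intro t ht
      have ht' := Finset.mem_of_mem_erase ht
      rcases Finset.mem_insert.1 ht' with rfl | ht'
      · simp [hB1]
      · simp [hB1, Finset.mem_of_mem_erase ht']

end Endgame

/-! ### Keeping the red cells away from the unmatched lines. -/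

section Opening

variable {m n : ℕ}

/-- The cell `r` lies in a row that `M` does not meet. -/
def RowFree (M : Finset (Fin n × Fin n)) (r : Fin n × Fin n) : Prop := ∀ t ∈ M, t.1 ≠ r.1

/-- The cell `r` lies in a column that `M` does not meet. -/
def ColFree (M : Finset (Fin n × Fin n)) (r : Fin n × Fin n) : Prop := ∀ t ∈ M, t.2 ≠ r.2

/-- Either no red cell meets an unmatched line, and Bob has wasted a move, or a single red cell
meets unmatched lines, in fact exactly one of them. -/
def Sparse (M R : Finset (Fin n × Fin n)) : Prop :=
  (¬ IsMatchingSet R ∧ ∀ r ∈ R, ¬ RowFree M r ∧ ¬ ColFree M r) ∨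
  (∃ q ∈ R, RowFree M q ∧ ¬ ColFree M q ∧ ∀ r ∈ R, r ≠ q → ¬ RowFree M r ∧ ¬ ColFree M r) ∨
  (∃ q ∈ R, ¬ RowFree M q ∧ ColFree M q ∧ ∀ r ∈ R, r ≠ q → ¬ RowFree M r ∧ ¬ ColFree M r)

theorem rowFree_insert {M : Finset (Fin n × Fin n)} {c r : Fin n × Fin n} :
    RowFree (insert c M) r ↔ c.1 ≠ r.1 ∧ RowFree M r := by
  simp [RowFree]

theorem colFree_insert {M : Finset (Fin n × Fin n)} {c r : Fin n × Fin n} :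
    ColFree (insert c M) r ↔ c.2 ≠ r.2 ∧ ColFree M r := by
  simp [ColFree]

theorem exists_unmatched_row {M : Finset (Fin n × Fin n)} (hM : M.card + 2 ≤ n) (a : Fin n) :
    ∃ b, b ≠ a ∧ ∀ t ∈ M, t.1 ≠ b := by
  have : (insert a (M.image Prod.fst)).card < (Finset.univ : Finset (Fin n)).card := by
    have h1 := Finset.card_insert_le a (M.image Prod.fst)
    have h2 := Finset.card_image_le (s := M) (f := Prod.fst)
    rw [Finset.card_univ, Fintype.card_fin]
    omega
  obtain ⟨b, -, hb⟩ := Finset.exists_mem_notMem_of_card_lt_card this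
  rw [Finset.mem_insert, not_or] at hb
  exact ⟨b, hb.1, fun t ht h => hb.2 (Finset.mem_image.2 ⟨t, ht, h⟩)⟩

theorem exists_unmatched_col {M : Finset (Fin n × Fin n)} (hM : M.card + 2 ≤ n) (a : Fin n) :
    ∃ b, b ≠ a ∧ ∀ t ∈ M, t.2 ≠ b := by
  obtain ⟨b, hb, h⟩ := exists_unmatched_row (M := swapCells M) (by rwa [card_swapCells]) a
  exact ⟨b, hb, fun t ht => h t.swap (by rwa [mem_swapCells, Prod.swap_swap])⟩

/-- Alice can answer every move of Bob so as to keep the position sparse. -/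
theorem exists_sparse_reply {M R : Finset (Fin n × Fin n)} (hM : M.card + 2 ≤ n)
    (hs : Sparse M R ∨ (R = ∅ ∧ M.card = 1)) {d : Fin n × Fin n} (hdM : d ∉ M) (hdR : d ∉ R) :
    ∃ c, c ∉ insert d R ∧ RowFree M c ∧ ColFree M c ∧ Sparse (insert c M) (insert d R) := by
  obtain ⟨a, had, ha⟩ := exists_unmatched_row hM d.1
  obtain ⟨b, hbd, hb⟩ := exists_unmatched_col hM d.2
  have hdm : ∀ r, r ∈ insert d R ↔ r = d ∨ r ∈ R := fun r => Finset.mem_insert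
  have hmono : ¬ IsMatchingSet R → ¬ IsMatchingSet (insert d R) := fun h h' =>
    h (h'.mono (Finset.subset_insert _ _))
  -- When no earlier red cell matters, Alice matches the row of `d` if `d` meets two unmatched
  -- lines, and otherwise avoids its lines. A `d` meeting none is acceptable only if Bob has already
  -- wasted a move.
  have hquiet : (∀ r ∈ R, ¬ RowFree M r ∧ ¬ ColFree M r) →
      (¬ RowFree M d → ¬ ColFree M d → ¬ IsMatchingSet R) →
      ∃ c, c ∉ insert d R ∧ RowFree M c ∧ ColFree M c ∧ Sparse (insert c M) (insert d R) := by
    intro hR hw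
    by_cases h1 : RowFree M d <;> by_cases h2 : ColFree M d
    · refine ⟨(d.1, b), ?_, h1, hb, Or.inr (Or.inr ⟨d, ?_⟩)⟩ <;>
      grind [rowFree_insert, colFree_insert, RowFree, ColFree]
    · refine ⟨(a, b), ?_, ha, hb, Or.inr (Or.inl ⟨d, ?_⟩)⟩ <;>
      grind [rowFree_insert, colFree_insert, RowFree, ColFree]
    · refine ⟨(a, b), ?_, ha, hb, Or.inr (Or.inr ⟨d, ?_⟩)⟩ <;>
      grind [rowFree_insert, colFree_insert, RowFree, ColFree]
    · refine ⟨(a, b), ?_, ha, hb, Or.inl ?_⟩ <;>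
      grind [rowFree_insert, colFree_insert, RowFree, ColFree]
  rcases hs with (⟨hw, hR⟩ | ⟨q, hqR, hq1, hq2, hR⟩ | ⟨q, hqR, hq1, hq2, hR⟩) | ⟨rfl, hM1⟩
  · exact hquiet hR fun _ _ => hw
  · obtain ⟨a', haq, ha'⟩ := exists_unmatched_row hM q.1
    by_cases h1 : RowFree M d <;> by_cases h2 : ColFree M d
    -- Alice neutralises `q` by matching its row. If `d` lies in another row, she also takes the
    -- column of `d`, so that `d` keeps only its free row.
    · by_cases hdq : d.1 = q.1
      · refine ⟨(q.1, b), ?_, hq1, hb, Or.inr (Or.inr ⟨d, ?_⟩)⟩ <;>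
        grind [rowFree_insert, colFree_insert, RowFree, ColFree]
      · refine ⟨(q.1, d.2), ?_, hq1, h2, Or.inr (Or.inl ⟨d, ?_⟩)⟩ <;>
        grind [rowFree_insert, colFree_insert, RowFree, ColFree]
    · by_cases hdq : d.1 = q.1
      -- Two red cells in one row are Bob's wasted move, so that row can be matched and no red cell
      -- need remain on an unmatched line.
      · have hw : ¬ IsMatchingSet (insert d R) := fun h => hdR <| by
          rwa [h.1 (Finset.mem_insert_self _ _) (Finset.mem_insert_of_mem hqR) hdq]
        refine ⟨(q.1, b), ?_, hq1, hb, Or.inl ⟨hw, ?_⟩⟩ <;>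
        grind [rowFree_insert, colFree_insert, RowFree, ColFree]
      · refine ⟨(q.1, b), ?_, hq1, hb, Or.inr (Or.inl ⟨d, ?_⟩)⟩ <;>
        grind [rowFree_insert, colFree_insert, RowFree, ColFree]
    · refine ⟨(q.1, b), ?_, hq1, hb, Or.inr (Or.inr ⟨d, ?_⟩)⟩ <;>
      grind [rowFree_insert, colFree_insert, RowFree, ColFree]
    -- Here `d` is harmless, and Alice deliberately leaves the row of `q` unmatched: without `q` she
    -- would have to exhibit a wasted red move.
    · refine ⟨(a', b), ?_, ha', hb, Or.inr (Or.inl ⟨q, ?_⟩)⟩ <;>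
      grind [rowFree_insert, colFree_insert, RowFree, ColFree]
  · obtain ⟨b', hbq, hb'⟩ := exists_unmatched_col hM q.2
    by_cases h1 : RowFree M d <;> by_cases h2 : ColFree M d
    · by_cases hdq : d.2 = q.2
      · refine ⟨(a, q.2), ?_, ha, hq2, Or.inr (Or.inl ⟨d, ?_⟩)⟩ <;>
        grind [rowFree_insert, colFree_insert, RowFree, ColFree]
      · refine ⟨(d.1, q.2), ?_, h1, hq2, Or.inr (Or.inr ⟨d, ?_⟩)⟩ <;>
        grind [rowFree_insert, colFree_insert, RowFree, ColFree]
    · refine ⟨(a, q.2), ?_, ha, hq2, Or.inr (Or.inl ⟨d, ?_⟩)⟩ <;>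
      grind [rowFree_insert, colFree_insert, RowFree, ColFree]
    · by_cases hdq : d.2 = q.2
      · have hw : ¬ IsMatchingSet (insert d R) := fun h => hdR <| by
          rwa [h.2 (Finset.mem_insert_self _ _) (Finset.mem_insert_of_mem hqR) hdq]
        refine ⟨(a, q.2), ?_, ha, hq2, Or.inl ⟨hw, ?_⟩⟩ <;>
        grind [rowFree_insert, colFree_insert, RowFree, ColFree]
      · refine ⟨(a, q.2), ?_, ha, hq2, Or.inr (Or.inr ⟨d, ?_⟩)⟩ <;>
        grind [rowFree_insert, colFree_insert, RowFree, ColFree]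
    · refine ⟨(a, b'), ?_, ha, hb', Or.inr (Or.inr ⟨q, ?_⟩)⟩ <;>
      grind [rowFree_insert, colFree_insert, RowFree, ColFree]
  -- After Alice's first move, the only cell meeting no unmatched line is her own, so Bob's first
  -- move must meet one.
  · refine hquiet (by simp) fun h1 h2 => absurd ?_ hdM
    obtain ⟨e, rfl⟩ := Finset.card_eq_one.1 hM1
    simp only [RowFree, ColFree, Finset.mem_singleton, forall_eq, ne_eq, not_not] at h1 h2
    exact Finset.mem_singleton.2 (Prod.ext h1.symm h2.symm)

/-- Alice wins when Bob has answered her threat to complete an almost perfect matching in a sparse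
position. -/
theorem winsFrom_of_sparse_of_block (hn : 4 ≤ n) {M R : Finset (Fin n × Fin n)}
    (hM : IsMatchingSet M) (hMc : M.card = n - 1) (hRc : R.card = n - 2) (hs : Sparse M R)
    {x y : Fin n} (hx : ∀ t ∈ M, t.1 ≠ x) (hy : ∀ t ∈ M, t.2 ≠ y) (hxy : (x, y) ∉ R) :
    WinsFrom n M (insert (x, y) R) := by
  have hRc' : (insert (x, y) R).card = n - 1 := by
    rw [Finset.card_insert_of_notMem hxy]
    omega
  have hrow : ∀ r : Fin n × Fin n, r.1 = x → RowFree M r := by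
    rintro r rfl
    exact hx
  have hcol : ∀ r : Fin n × Fin n, r.2 = y → ColFree M r := by
    rintro r rfl
    exact hy
  have hrow' : ∀ r : Fin n × Fin n, RowFree M r → r.1 = x := by
    intro r hr
    by_contra hne
    have hsub : ({r.1, x} : Finset (Fin n)) ⊆ (M.image Prod.fst)ᶜ := by
      intro i hi
      rw [Finset.mem_compl, Finset.mem_image]
      rintro ⟨t, ht, rfl⟩
      rcases Finset.mem_insert.1 hi with h | h
      · exact hr t ht h
      · exact hx t ht (Finset.mem_singleton.1 h)
    have := Finset.card_le_card hsub
    rw [Finset.card_pair hne, Finset.card_compl, Finset.card_image_of_injOn hM.1,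
      Fintype.card_fin] at this
    omega
  have hcol' : ∀ r : Fin n × Fin n, ColFree M r → r.2 = y := by
    intro r hr
    by_contra hne
    have hsub : ({r.2, y} : Finset (Fin n)) ⊆ (M.image Prod.snd)ᶜ := by
      intro i hi
      rw [Finset.mem_compl, Finset.mem_image]
      rintro ⟨t, ht, rfl⟩
      rcases Finset.mem_insert.1 hi with h | h
      · exact hr t ht h
      · exact hy t ht (Finset.mem_singleton.1 h)
    have := Finset.card_le_card hsub
    rw [Finset.card_pair hne, Finset.card_compl, Finset.card_image_of_injOn hM.2,
      Fintype.card_fin] at this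
    omega
  rcases hs with ⟨hw, hR⟩ | ⟨q, hqR, hq1, hq2, hR⟩ | ⟨q, hqR, hq1, hq2, hR⟩
  · have h1 : (insert (x, y) R).filter (fun r => r.2 = y) = {(x, y)} := by
      ext r
      grind
    have h2 : (insert (x, y) R).filter (fun r => r.2 ≠ y) = R := by
      ext r
      grind
    refine winsFrom_of_deficient hn hM hMc hRc' hx hy (Finset.mem_insert_self _ _) ?_ ?_ ?_
    · grind
    · simp [h1]
    · rw [h2]
      exact Or.inr hw
  -- The extra red cell lies in row `x`; transposing puts it in the missing column, where the
  -- endgame lemma permits a second red cell.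
  · have h1 : (swapCells (insert (x, y) R)).filter (fun r => r.2 = x) = {(y, x), q.swap} := by
      ext ⟨i, j⟩
      simp only [Finset.mem_filter, mem_swapCells, Finset.mem_insert, Finset.mem_singleton,
        Prod.swap_prod_mk, Prod.ext_iff, Prod.fst_swap, Prod.snd_swap]
      grind
    have hne : (y, x) ≠ q.swap := by
      rintro h
      exact hq2 (hcol q (congrArg Prod.fst h).symm)
    rw [← swapCells_swapCells M, ← swapCells_swapCells (insert (x, y) R)]
    refine (winsFrom_of_deficient hn hM.swapCells (by rwa [card_swapCells])
      (by rwa [card_swapCells]) (x := y) (y := x) ?_ ?_ ?_ ?_ ?_ ?_).swapCells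
    · exact fun t ht => hy t.swap (mem_swapCells.1 ht)
    · exact fun t ht => hx t.swap (mem_swapCells.1 ht)
    · simp [mem_swapCells]
    · rintro ⟨i, j⟩ hr rfl
      simp only [mem_swapCells, Finset.mem_insert, Prod.swap_prod_mk, Prod.mk.injEq] at hr ⊢
      grind
    · rw [h1, Finset.card_pair hne]
    · rw [h1, Finset.card_pair hne]
      exact Or.inl rfl
  · have h1 : (insert (x, y) R).filter (fun r => r.2 = y) = {(x, y), q} := by
      ext r
      grind
    have hne : (x, y) ≠ q := by
      rintro rfl
      exact hq1 hx
    refine winsFrom_of_deficient hn hM hMc hRc' hx hy (Finset.mem_insert_self _ _) ?_ ?_ ?_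
    · grind
    · rw [h1, Finset.card_pair hne]
    · rw [h1, Finset.card_pair hne]
      exact Or.inl rfl

/-- Sparseness allows no red cell on both an unmatched row and an unmatched column, so every cell
extending Alice's matching is still available. -/
theorem Sparse.not_free {M R : Finset (Fin n × Fin n)} (hs : Sparse M R) {c : Fin n × Fin n}
    (h1 : RowFree M c) (h2 : ColFree M c) : c ∉ R := by
  intro hc
  rcases hs with ⟨_, hR⟩ | ⟨q, hqR, hq1, hq2, hR⟩ | ⟨q, hqR, hq1, hq2, hR⟩ <;> grind

theorem winsFrom_of_sparse (hn : 4 ≤ n) (j : ℕ) : ∀ M R : Finset (Fin n × Fin n),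
    IsMatchingSet M → M.card + (j + 1) = n → R.card + 1 = M.card →
    (Sparse M R ∨ (R = ∅ ∧ M.card = 1)) → ∀ d, d ∉ M → d ∉ R → WinsFrom n M (insert d R) := by
  induction j with
  | zero =>
    intro M R hM hMc hRc hs d hdM hdR
    have hs' : Sparse M R := hs.resolve_right fun h => by omega
    obtain ⟨⟨x, y⟩, -, hx, hy⟩ := exists_free_cell (R := ∅) hM (by
      rw [Finset.card_empty]
      exact pow_pos (by omega) 2)
    have hxyR := hs'.not_free hx hy
    by_cases hd : d = (x, y)
    · subst hd
      exact winsFrom_of_sparse_of_block hn hM (by omega) (by omega) hs' hx hy hdR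
    · refine .win _ _ (x, y) (fun h => ?_) (fun h => hx _ h rfl) ?_ ?_
      · have := h.le_card
        rw [Finset.card_insert_of_notMem hdR] at this
        omega
      · rw [Finset.mem_insert]
        exact fun h => h.elim (fun h => hd h.symm) hxyR
      · exact hasMatching_insert_of_card hM (by omega) (Finset.subset_insert _ _) hx hy
          (Finset.mem_insert_self _ _)
  | succ j ih =>
    intro M R hM hMc hRc hs d hdM hdR
    obtain ⟨c, hc, h1, h2, hs'⟩ := exists_sparse_reply (by omega) hs hdM hdR
    have hcM : c ∉ M := fun h => h1 c h rfl
    have hM' : IsMatchingSet (insert c M) := hM.insert h1 h2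
    have hcard : (insert c M).card = M.card + 1 := Finset.card_insert_of_notMem hcM
    have hRc' : (insert d R).card = R.card + 1 := Finset.card_insert_of_notMem hdR
    refine .step _ _ c (fun h => ?_) hcM hc ?_
      (ih _ _ hM' (by omega) (by omega) (Or.inl hs'))
    · have := h.le_card
      omega
    · obtain ⟨e, -, he1, he2⟩ := exists_free_cell (R := ∅) hM' (by
        rw [Finset.card_empty]
        exact pow_pos (by omega) 2)
      exact ⟨e, fun h => he1 _ h rfl, hs'.not_free he1 he2⟩

theorem aliceWins_perfectMatching (hn : 4 ≤ n) :
    AliceWins (matchingGraph n) (completeBipartiteGraph (Fin n) (Fin n)) := by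
  have : NeZero n := ⟨by omega⟩
  refine WinsFrom.aliceWins (.step ∅ ∅ (0, 0) (fun h => ?_) (by simp) (by simp)
    ⟨(0, ⟨1, by omega⟩), by simp, by simp⟩ ?_)
  · have := h.le_card
    rw [Finset.card_empty] at this
    omega
  · exact winsFrom_of_sparse hn (n - 2) _ _
      (isMatchingSet_empty.insert (by simp) (by simp))
      (by rw [LawfulSingleton.insert_empty_eq, Finset.card_singleton]; omega) (by simp)
      (Or.inr ⟨rfl, by simp⟩)

end Opening

end AchievementGame

/-! ### Assembly of the cases. -/

open AchievementGame in
theorem theorem4p1 (m : ℕ) :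
    ((m = 2 ∨ m = 3) → IsBipartiteAchievementNumber (matchingGraph m) (m + 1)) ∧
    ((m = 1 ∨ 4 ≤ m) → IsBipartiteAchievementNumber (matchingGraph m) m) := by
  constructor
  · rintro (rfl | rfl)
    -- With `n = m + 1` the tightest greedy condition is the last, `k = m - 1`, which reads `m - 1 <
    -- 4`.
    · refine ⟨aliceWins_of_greedy (by norm_num) (by decide), fun k hk => ?_⟩
      by_contra hlt
      rcases (by omega : k < 2 ∨ k = 2) with h | rfl
      · exact not_aliceWins_of_lt h hk
      · exact not_aliceWins_two hk
    · refine ⟨aliceWins_of_greedy (by norm_num) (by decide), fun k hk => ?_⟩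
      by_contra hlt
      rcases (by omega : k < 3 ∨ k = 3) with h | rfl
      · exact not_aliceWins_of_lt h hk
      · exact not_aliceWins_three hk
  · refine fun hm => ⟨?_, fun k hk => not_lt.1 fun h => not_aliceWins_of_lt h hk⟩
    rcases hm with rfl | hm
    · exact aliceWins_of_greedy (by norm_num) (by decide)
    · exact aliceWins_perfectMatching hm
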